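/- Let $\mathcal V$ be a variety of algebras (a class of nonempty algebras with finitary operations, defined by identities). Let $\mathbf G$ and $\mathbf H$ be undirected graphs whose edges are labeled by $n$ labels $1,\dots,n$, each with $h$ distinguished vertices, $d_1,\dots,d_h$ in $\mathbf G$ and $e_1,\dots,e_h$ in $\mathbf H$; assume that $\mathbf G$ is finite, while $\mathbf H$ may be infinite. If $R_1,\dots,R_n$ are reflexive and symmetric binary relations on a set $A$, let $\mathbf G(R_1,\dots,R_n)\subseteq A^h$ be the set of all $(a_1,\dots,a_h)$ for which there is a map $v\mapsto c_v$ from the vertices of $\mathbf G$ to $A$ such that $a_j=c_{d_j}$ for $j=1,\dots,h$, and $c_v\mathrel{R_i}c_{v'}$ whenever $v$ and $v'$ are connected by an edge labeled $i$; define $\mathbf H(R_1,\dots,R_n)$ likewise. For each $i$, let $\sim_i$ be the least equivalence relation on the vertices of $\mathbf G$ such that $v\sim_i v'$ whenever $v$ and $v'$ are connected by an edge labeled $i$. For a class $X$ of $\sim_i$ and $x\in X$, let $k_i(x,X)$ be the smallest integer $k \geq 0$ such that every element of $X$ can be connected to $x$ by a path of length $\le k$ contained in $X$ and consisting of edges labeled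 $i$. Let $k_i(X)=\min_{x\in X}k_i(x,X)$ and $k_i=2\cdot\max_X k_i(X)$, where $X$ runs over the classes of $\sim_i$ (and $k_i=0$ if $\mathbf G$ has no vertices). A tolerance of an algebra is a reflexive and symmetric binary relation compatible with the operations; a congruence is a transitive tolerance. For a tolerance $\Theta$ let $\Theta^k=\Theta\circ\dots\circ\Theta$ with $k$ occurrences of $\Theta$; $\Theta^0$ is the identity relation. Then the following are equivalent. (i) $\mathbf G(\alpha_1,\dots,\alpha_n)\subseteq\mathbf H(\alpha_1,\dots,\alpha_n)$ for every algebra in $\mathcal V$ and all congruences $\alpha_1,\dots,\alpha_n$ of it. (ii) $\mathbf G(\Theta_1,\dots,\Theta_n)\subseteq\mathbf H(\Theta_1^{k_1},\dots,\Theta_n^{k_n})$ for every algebra in $\mathcal V$ and all tolerances $\Theta_1,\dots,\Theta_n$ of it. -/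

import Mathlib

universe u u' w x y

/-- The `k`-fold relational product `R ∘ R ∘ ⋯ ∘ R` with `k` occurrences of `R`
(the identity relation for `k = 0`). -/
def relPow {A : Type*} (R : A → A → Prop) : ℕ → A → A → Prop
  | 0 => Eq
  | k + 1 => Relation.Comp (relPow R k) R

/-- The binary relation `R` is compatible with all operations of the algebra `A`. -/
def IsCompatible (L : FirstOrder.Language.{u, u'}) {A : Type*} [L.Structure A] (R : A → A → Prop) : Prop :=
  ∀ (m : ℕ) (f : L.Functions m) (a b : Fin m → A), (∀ j, R (a j) (b j)) →
    R (FirstOrder.Language.Structure.funMap f a) (FirstOrder.Language.Structure.funMap f b)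

/-- A tolerance of the algebra `A`: a reflexive, symmetric, compatible binary relation. -/
structure IsTolerance (L : FirstOrder.Language.{u, u'}) {A : Type*} [L.Structure A]
    (R : A → A → Prop) : Prop where
  refl : ∀ a, R a a
  symm : ∀ a b, R a b → R b a
  compatible : IsCompatible L R

/-- A congruence of the algebra `A`: a compatible equivalence relation. -/
structure IsCongruence (L : FirstOrder.Language.{u, u'}) {A : Type*} [L.Structure A]
    (R : A → A → Prop) : Prop where
  equivalence : Equivalence R
  compatible : IsCompatible L R

/-- The algebra `A` belongs to the variety axiomatized by the set `E` of identities
(an identity `s ≈ t` is the pair `(s, t)` of terms in the variables `x₀, x₁, …`). -/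
def InVariety {L : FirstOrder.Language.{u, u'}} (E : Set (L.Term ℕ × L.Term ℕ)) (A : Type*)
    [L.Structure A] : Prop :=
  ∀ e ∈ E, ∀ v : ℕ → A, e.1.realize v = e.2.realize v

/-- An undirected graph on the vertex set `V` with edges labeled by `n` labels and with `h`
distinguished vertices. Edges with different labels may join the same vertices. -/
structure LabeledGraph (n h : ℕ) (V : Type*) where
  /-- `Edge i v v'`: some edge labeled by the `i`-th label connects `v` and `v'`. -/
  Edge : Fin n → V → V → Prop
  edge_symm : ∀ i v v', Edge i v v' → Edge i v' v
  /-- the distinguished vertices -/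
  d : Fin h → V

namespace LabeledGraph

variable {n h : ℕ} {V : Type*}

/-- The `h`-ary relation `G(R₁, …, Rₙ)` on `A`: the `h`-tuples that can be connected by `G`. -/
def rel (G : LabeledGraph n h V) {A : Type*} (R : Fin n → A → A → Prop) : Set (Fin h → A) :=
  {a | ∃ c : V → A, (∀ j, a j = c (G.d j)) ∧ ∀ i v v', G.Edge i v v' → R i (c v) (c v')}

/-- The least equivalence relation `∼ᵢ` relating vertices joined by an edge with label `i`. -/
def sim (G : LabeledGraph n h V) (i : Fin n) : V → V → Prop :=
  Relation.EqvGen (G.Edge i)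

/-- The set of all equivalence classes of `∼ᵢ`. -/
def classes (G : LabeledGraph n h V) (i : Fin n) : Set (Set V) :=
  {X | ∃ v, X = {v' | G.sim i v v'}}

/-- Some path of length `l`, contained in `X` and with all edges labeled by `i`, joins `v`
and `v'`. -/
def PathIn (G : LabeledGraph n h V) (i : Fin n) (X : Set V) (l : ℕ) (v v' : V) : Prop :=
  relPow (fun p q => p ∈ X ∧ q ∈ X ∧ G.Edge i p q) l v v'

/-- `kᵢ(v, X)`: the smallest `k` such that each element of `X` can be connected to `v` by a path
of length at most `k` contained in `X`. -/
noncomputable def ecc (G : LabeledGraph n h V) (i : Fin n) (X : Set V) (v : V) : ℕ :=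
  sInf {k | ∀ v' ∈ X, ∃ l ≤ k, G.PathIn i X l v' v}

/-- `kᵢ(X)`: the radius of `X`. -/
noncomputable def radius (G : LabeledGraph n h V) (i : Fin n) (X : Set V) : ℕ :=
  sInf {r | ∃ v ∈ X, r = G.ecc i X v}

/-- `kᵢ`: twice the maximal radius of the classes of `∼ᵢ`, for `G` finite. -/
noncomputable def k (G : LabeledGraph n h V) (i : Fin n) : ℕ :=
  2 * sSup {r | ∃ X ∈ G.classes i, r = G.radius i X}

end LabeledGraph

/-!
The direction from tolerances to congruences holds because every power of an equivalence relation
is contained in the relation itself.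

For the converse, write `kᵢ = 2 Kᵢ` with `Kᵢ` the largest radius of a class of `∼ᵢ`, and choose in
each class a center `rᵢ v`, depending only on the class of `v`, that is reached from `v` by a path of
length at most `Kᵢ` (`LabeledGraph.exists_center`). Given tolerances `Θᵢ` of `A` and a map `c` from
the vertices of `G` to `A` that respects the edges, put `Rᵢ = Θᵢ ^ Kᵢ`; this is again a tolerance,
and `c v Rᵢ c (rᵢ v)`. The tuples `(a, b₁, …, bₙ)` with `a Rᵢ bᵢ` for all `i` form a subalgebra
`TolerancePower` of a power of `A`, hence an algebra of the variety, and equality of the coordinate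
`bᵢ` is a congruence `αᵢ` on it. The elements `x_v = (c v, c (r₁ v), …, c (rₙ v))` witness that the
tuple of the `x_v`, with `v` distinguished, belongs to `G(α₁, …, αₙ)`, hence to `H(α₁, …, αₙ)`. If
`y_w` witness the latter and `w`, `w'` are joined by an edge labeled `i`, then the first
coordinates of `y_w` and `y_w'` are both `Rᵢ`-related to the common coordinate `bᵢ`, so they are
related by `Rᵢ ∘ Rᵢ = Θᵢ ^ kᵢ`.
-/

/-! ### Relational powers -/

section relPow

variable {A : Type*} {R : A → A → Prop}

theorem relPow_add {a b c : A} {k l : ℕ} (h₁ : relPow R k a b) (h₂ : relPow R l b c) :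
    relPow R (k + l) a c := by
  induction l generalizing c with
  | zero => cases h₂; exact h₁
  | succ l ih =>
    obtain ⟨d, hd, hdc⟩ := h₂
    exact ⟨d, ih hd, hdc⟩

theorem relPow_one {a b : A} (h : R a b) : relPow R 1 a b := ⟨a, rfl, h⟩

theorem relPow_symm (hR : ∀ a b, R a b → R b a) {k : ℕ} {a b : A} (h : relPow R k a b) :
    relPow R k b a := by
  induction k generalizing b with
  | zero => exact h.symm
  | succ k ih =>
    obtain ⟨c, hc, hcb⟩ := h
    rw [Nat.add_comm]
    exact relPow_add (relPow_one (hR _ _ hcb)) (ih hc)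

theorem relPow_refl (hR : ∀ a, R a a) (k : ℕ) (a : A) : relPow R k a a := by
  induction k with
  | zero => rfl
  | succ k ih => exact ⟨a, ih, hR a⟩

theorem relPow_mono_right (hR : ∀ a, R a a) {k l : ℕ} (hkl : k ≤ l) {a b : A}
    (h : relPow R k a b) : relPow R l a b := by
  obtain ⟨m, rfl⟩ := Nat.exists_eq_add_of_le hkl
  exact relPow_add h (relPow_refl hR m b)

theorem relPow_map {B : Type*} {S : B → B → Prop} {f : A → B} (hf : ∀ a b, R a b → S (f a) (f b))
    {k : ℕ} {a b : A} (h : relPow R k a b) : relPow S k (f a) (f b) := by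
  induction k generalizing b with
  | zero => exact congrArg f h
  | succ k ih =>
    obtain ⟨c, hc, hcb⟩ := h
    exact ⟨f c, ih hc, hf _ _ hcb⟩

theorem relPow_le_of_equivalence (hR : Equivalence R) {k : ℕ} {a b : A} (h : relPow R k a b) :
    R a b := by
  induction k generalizing b with
  | zero => cases h; exact hR.refl a
  | succ k ih =>
    obtain ⟨c, hc, hcb⟩ := h
    exact hR.trans (ih hc) hcb

theorem IsTolerance.relPow {L : FirstOrder.Language.{u, u'}} [L.Structure A]
    (hR : IsTolerance L R) (k : ℕ) : IsTolerance L (relPow R k) where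
  refl := relPow_refl hR.refl k
  symm _ _ := relPow_symm hR.symm
  compatible := by
    induction k with
    | zero => exact fun m f a b hab => congrArg _ (funext hab)
    | succ k ih =>
      intro m f a b hab
      choose c hc hcb using hab
      exact ⟨_, ih m f a c hc, hR.compatible m f c b hcb⟩

end relPow

/-! ### Centers of the classes of a finite labeled graph -/

namespace LabeledGraph

variable {n h : ℕ} {V : Type*} (G : LabeledGraph n h V) (i : Fin n)

theorem rel_mono {A : Type*} {R S : Fin n → A → A → Prop} (hRS : ∀ i a b, R i a b → S i a b) :
    G.rel R ⊆ G.rel S :=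
  fun _ ⟨c, hd, hc⟩ => ⟨c, hd, fun i v v' hv => hRS _ _ _ (hc i v v' hv)⟩

theorem exists_pathIn {X : Set V} (hX : ∀ v v', G.sim i v v' → (v ∈ X ↔ v' ∈ X)) {v v' : V}
    (h : G.sim i v v') (hv : v ∈ X) : ∃ l, G.PathIn i X l v v' := by
  unfold sim at h
  induction h with
  | rel v v' e => exact ⟨1, relPow_one ⟨hv, (hX _ _ (.rel _ _ e)).1 hv, e⟩⟩
  | refl v => exact ⟨0, rfl⟩
  | symm v v' e ih =>
    obtain ⟨l, hl⟩ := ih ((hX _ _ e).2 hv)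
    exact ⟨l, relPow_symm (fun _ _ ⟨hp, hq, e⟩ => ⟨hq, hp, G.edge_symm _ _ _ e⟩) hl⟩
  | trans u v w e _ ih₁ ih₂ =>
    obtain ⟨l, hl⟩ := ih₁ hv
    obtain ⟨m, hm⟩ := ih₂ ((hX _ _ e).1 hv)
    exact ⟨l + m, relPow_add hl hm⟩

/-- In a finite graph the infimum defining `ecc` is attained. -/
theorem exists_pathIn_le_ecc [Finite V] {X : Set V} (hX : X ∈ G.classes i) {v v' : V}
    (hv : v ∈ X) (hv' : v' ∈ X) : ∃ l ≤ G.ecc i X v, G.PathIn i X l v' v := by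
  obtain ⟨u, rfl⟩ := hX
  set X : Set V := {v' | G.sim i u v'}
  have hpath : ∀ p : X, ∃ l, G.PathIn i X l p v := fun p =>
    G.exists_pathIn i (fun a b hab => ⟨fun ha => .trans _ _ _ ha hab,
      fun hb => .trans _ _ _ hb (.symm _ _ hab)⟩) (.trans _ _ _ (.symm _ _ p.2) hv) p.2
  choose l hl using hpath
  obtain ⟨M, hM⟩ := (Set.finite_range l).bddAbove
  have hne : {k | ∀ v' ∈ X, ∃ l ≤ k, G.PathIn i X l v' v}.Nonempty :=
    ⟨M, fun p hp => ⟨l ⟨p, hp⟩, hM ⟨_, rfl⟩, hl ⟨p, hp⟩⟩⟩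
  exact Nat.sInf_mem hne v' hv'

/-- Each class of `∼ᵢ` has a center `r v`, at distance at most half of `kᵢ` from all `v` in it. -/
theorem exists_center [Finite V] : ∃ (K : ℕ) (r : V → V), G.k i = K + K ∧
    (∀ v v', G.sim i v v' → r v = r v') ∧
    ∀ v, ∃ l ≤ K, relPow (G.Edge i) l v (r v) := by
  have key : ∀ X ∈ G.classes i, ∃ x, ∀ v ∈ X,
      ∃ l ≤ sSup {r | ∃ X ∈ G.classes i, r = G.radius i X}, relPow (G.Edge i) l v x := by
    intro X hX
    have hne : {r | ∃ v ∈ X, r = G.ecc i X v}.Nonempty := by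
      obtain ⟨u, rfl⟩ := hX
      exact ⟨_, u, .refl u, rfl⟩
    obtain ⟨x, hx, hr⟩ : ∃ v ∈ X, G.radius i X = G.ecc i X v := Nat.sInf_mem hne
    have hfin : {r | ∃ X ∈ G.classes i, r = G.radius i X}.Finite :=
      ((Set.toFinite (G.classes i)).image (G.radius i)).subset
        fun _ ⟨Y, hY, hr⟩ => ⟨Y, hY, hr.symm⟩
    refine ⟨x, fun v hv => ?_⟩
    obtain ⟨l, hl, hp⟩ := G.exists_pathIn_le_ecc i hX hx hv
    exact ⟨l, (hl.trans hr.ge).trans (le_csSup hfin.bddAbove ⟨X, hX, rfl⟩),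
      relPow_map (f := id) (fun _ _ hpq => hpq.2.2) hp⟩
  choose x hx using key
  refine ⟨_, fun v => x {v' | G.sim i v v'} ⟨v, rfl⟩, Nat.two_mul _, fun v v' hvv' => ?_,
    fun v => hx _ _ v (.refl v)⟩
  have hclass : {w | G.sim i v w} = {w | G.sim i v' w} :=
    Set.ext fun w => ⟨.trans _ _ _ (.symm _ _ hvv'), .trans _ _ _ hvv'⟩
  simp only [hclass]

end LabeledGraph

/-! ### A subalgebra of a power determined by tolerances -/

/-- For tolerances `Rᵢ` of `A`, the subalgebra of a power of `A` consisting of the tuples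
`(a, b₁, …, bₙ)` with `a Rᵢ bᵢ` for all `i`; the coordinate `none` holds `a`, and `some i` holds
`bᵢ`. -/
def TolerancePower {ι A : Type*} (R : ι → A → A → Prop) : Type _ :=
  {f : Option ι → A // ∀ i, R i (f none) (f (some i))}

namespace TolerancePower

open FirstOrder.Language

variable {L : FirstOrder.Language.{u, u'}} {ι A : Type*} [L.Structure A] {R : ι → A → A → Prop}

/-- The algebra structure with coordinatewise operations. No relation symbol is interpreted
nontrivially; the language of an algebra has none. -/
abbrev algebraStructure (hR : ∀ i, IsTolerance L (R i)) : L.Structure (TolerancePower R) where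
  funMap f x := ⟨fun o => Structure.funMap f fun j => (x j).1 o,
    fun i => (hR i).compatible _ f _ _ fun j => (x j).2 i⟩
  RelMap _ _ := False

theorem realize_apply (hR : ∀ i, IsTolerance L (R i)) (t : L.Term ℕ) (v : ℕ → TolerancePower R)
    (o : Option ι) :
    (letI := algebraStructure hR; t.realize v).1 o = t.realize fun m => (v m).1 o := by
  induction t with
  | var m => rfl
  | func f ts ih => exact congrArg (Structure.funMap f) (funext ih)

theorem inVariety (hR : ∀ i, IsTolerance L (R i)) {E : Set (L.Term ℕ × L.Term ℕ)}
    (hA : InVariety E A) : letI := algebraStructure hR; InVariety E (TolerancePower R) := by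
  intro e he v
  refine Subtype.ext (funext fun o => ?_)
  exact (realize_apply hR e.1 v o).trans
    ((hA e he fun m => (v m).1 o).trans (realize_apply hR e.2 v o).symm)

theorem isCongruence_eq_apply (hR : ∀ i, IsTolerance L (R i)) (i : ι) :
    letI := algebraStructure hR
    IsCongruence L fun f g : TolerancePower R => f.1 (some i) = g.1 (some i) :=
  letI := algebraStructure hR
  { equivalence := ⟨fun _ => rfl, Eq.symm, Eq.trans⟩
    compatible := fun _ f _ _ hab => congrArg (Structure.funMap f) (funext hab) }

end TolerancePower

/-! ### Congruence inclusions and tolerance inclusions -/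

theorem theorem3 (L : FirstOrder.Language.{u, u'}) [L.IsAlgebraic] (E : Set (L.Term ℕ × L.Term ℕ))
    (n h : ℕ) (V : Type x) (W : Type y) [Finite V]
    (G : LabeledGraph n h V) (H : LabeledGraph n h W) :
    (∀ (A : Type (max u w)) [Nonempty A] [L.Structure A], InVariety E A →
        ∀ α : Fin n → A → A → Prop, (∀ i, IsCongruence L (α i)) → G.rel α ⊆ H.rel α) ↔
      (∀ (A : Type (max u w)) [Nonempty A] [L.Structure A], InVariety E A →
        ∀ Θ : Fin n → A → A → Prop, (∀ i, IsTolerance L (Θ i)) →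
          G.rel Θ ⊆ H.rel (fun i => relPow (Θ i) (G.k i))) := by
  refine ⟨fun hcon A _ _ hA Θ hΘ a ⟨c, hac, hc⟩ => ?_, fun htol A _ _ hA α hα => ?_⟩
  · choose K r hK hr hpath using G.exists_center
    have hR : ∀ i, IsTolerance L (relPow (Θ i) (K i)) := fun i => (hΘ i).relPow (K i)
    have hcr : ∀ i v, relPow (Θ i) (K i) (c v) (c (r i v)) := fun i v => by
      obtain ⟨l, hl, hp⟩ := hpath i v
      exact relPow_mono_right (hΘ i).refl hl (relPow_map (hc i) hp)
    let B := TolerancePower fun i => relPow (Θ i) (K i)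
    let : L.Structure B := TolerancePower.algebraStructure hR
    have : Nonempty B := ‹Nonempty A›.map fun a => ⟨fun _ => a, fun i => (hR i).refl a⟩
    let x : V → B := fun v => ⟨fun o => o.elim (c v) fun i => c (r i v), fun i => hcr i v⟩
    have hx : (fun j => x (G.d j)) ∈ G.rel fun i (f g : B) => f.1 (some i) = g.1 (some i) :=
      ⟨x, fun _ => rfl, fun i v v' e => congrArg c (hr i v v' (.rel _ _ e))⟩
    obtain ⟨y, hxy, hy⟩ := hcon B (TolerancePower.inVariety hR hA) _
      (TolerancePower.isCongruence_eq_apply hR) hx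
    refine ⟨fun w => (y w).1 none, fun j => (hac j).trans (congrArg (fun f : B => f.1 none) (hxy j)),
      fun i w w' e => ?_⟩
    have hyw' := (hR i).symm _ _ ((y w').2 i)
    rw [← hy i w w' e] at hyw'
    change relPow (Θ i) (G.k i) _ _
    rw [hK i]
    exact relPow_add ((y w).2 i) hyw'
  · refine (htol A hA α fun i => ⟨(hα i).equivalence.refl, fun _ _ => (hα i).equivalence.symm,
      (hα i).compatible⟩).trans (H.rel_mono fun i _ _ => relPow_le_of_equivalence (hα i).equivalence)
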